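/- Let $n\in\mathbb N$ and let $K\subseteq\mathbb R^n$ be an origin-symmetric convex body (a compact convex set with nonempty interior such that $K=-K$). Let $\rho_K(x)=\sup\{\lambda\ge 0:\lambda x\in K\}\in[0,\infty]$ be its radial function (so $\rho_K(0)=\infty$, and $\rho_K(0)^{-1}=0$), let $\gamma_n$ be the standard Gaussian probability measure on $\mathbb R^n$, let $B_2^n$ be the closed Euclidean unit ball, and let $B_\infty^n=\{x\in\mathbb R^n:|x_i|\le 1 \text{ for all } i\}$. Suppose that $B_2^n$ is the ellipsoid of maximal volume contained in $K$ (its John ellipsoid). Then, for every $t>0$, \[ \gamma_n\big(\{x\in\mathbb R^n:\rho_K(x)^{-1}>t\}\big)\ \ge\ \gamma_n\big(\{x\in\mathbb R^n:\rho_{B_\infty^n}(x)^{-1}>t\}\big), \] and, for every $t>0$, equality holds in this inequality if and only if $K$ is a rotation of $B_\infty^n$. -/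

import Mathlib

open MeasureTheory ProbabilityTheory
open scoped ENNReal NNReal

namespace JohnPosition

/-- The Euclidean space `ℝⁿ`. -/
abbrev Euc (n : ℕ) : Type := EuclideanSpace ℝ (Fin n)

/-- The closed Euclidean unit ball `B₂ⁿ`. -/
def unitBall (n : ℕ) : Set (Euc n) := Metric.closedBall 0 1

/-- The cube `B_∞ⁿ = {x : |x_i| ≤ 1 for all i}`. -/
def cube (n : ℕ) : Set (Euc n) := {x | ∀ i, |x i| ≤ 1}

/-- The radial function `ρ_K(x) = sup {r ≥ 0 : r x ∈ K}`, with values in `[0, ∞]`.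
For a compact `K` with the origin in its interior, it is positive and finite at every `x ≠ 0`,
and `ρ_K(0) = ∞`, so that `ρ_K(0)⁻¹ = 0`. -/
noncomputable def radial {n : ℕ} (K : Set (Euc n)) (x : Euc n) : ℝ≥0∞ :=
  ⨆ (r : ℝ≥0) (_ : (r : ℝ) • x ∈ K), (r : ℝ≥0∞)

/-- A (solid, nondegenerate) ellipsoid: the image of the unit ball under an affine bijection. -/
def IsEllipsoid {n : ℕ} (E : Set (Euc n)) : Prop :=
  ∃ f : Euc n ≃ᵃ[ℝ] Euc n, E = f '' unitBall n

/-- `E` is an ellipsoid of maximal volume among all ellipsoids contained in `K`. -/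
def IsMaxVolumeEllipsoid {n : ℕ} (E K : Set (Euc n)) : Prop :=
  IsEllipsoid E ∧ E ⊆ K ∧ ∀ E' : Set (Euc n), IsEllipsoid E' → E' ⊆ K → volume E' ≤ volume E

/-- `K` is the image of `L` under a rotation, i.e. a linear isometry of determinant one. -/
def IsRotationOf {n : ℕ} (K L : Set (Euc n)) : Prop :=
  ∃ R : Euc n ≃ₗᵢ[ℝ] Euc n, LinearMap.det (R.toLinearEquiv : Euc n →ₗ[ℝ] Euc n) = 1 ∧ K = R '' L

end JohnPosition

namespace JohnPosition

/-! For `t > 0` the set where `ρ_K⁻¹ > t` is the complement of `tK`, so the claim is that `tK` has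
Gaussian measure at most that of the cube `[-t, t]ⁿ`, which is `aⁿ` with `a = 2 * gaussPrimitive t`.

John's theorem (`exists_isUnitDecomposition`) writes the identity as `∑ c i • u i ⊗ u i` over unit
vectors with `⟪u i, x⟫ ≤ 1` on `K`. By symmetry `K` lies in the slabs `|⟪u i, x⟫| ≤ 1`, and it
remains to bound the measure of an intersection of slabs. This is a Brascamp–Lieb inequality, proved
by transport. Let `S` push the Gaussian conditioned on `[-t, t]` to the full Gaussian and put `Φ x =
∑ c i • S ⟪u i, x⟫ • u i`. Then `Φ` is injective on the open slabs, Ball's inequality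
`exp_sum_le_det` bounds `det DΦ` below by `∏ S' ^ c i`, and `∑ c i * S ⟪u i, x⟫ ^ 2 ≥ ‖Φ x‖ ^ 2`.
Together these dominate the Gaussian density at `x` by `aⁿ` times its pullback under `Φ`, and the
image has measure at most 1.

In the equality case the defect of the quadratic inequality vanishes on the slabs, that is, `S ⟪u i,
x⟫ = ⟪u i, Φ x⟫`. Along `x = s • u j` with `s → t` the function `S` blows up, which forces the `u i`
to be pairwise orthogonal or parallel (`inner_eq_zero_or_abs_eq_one`). The slabs then form a rotated
cube, and equality of measures makes `tK` fill it. -/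

/-- The unit vectors `u i` with the positive weights `c i` decompose the identity:
`∑ c i • u i ⊗ u i = 1`. -/
structure IsUnitDecomposition {E ι : Type*} [NormedAddCommGroup E] [InnerProductSpace ℝ E]
    [Fintype ι] (c : ι → ℝ) (u : ι → E) : Prop where
  pos : ∀ i, 0 < c i
  norm_eq_one : ∀ i, ‖u i‖ = 1
  sum_smul : ∀ x, ∑ i, (c i * inner ℝ (u i) x) • u i = x

/-! ### Decompositions of the identity and Ball's determinant inequality -/

namespace IsUnitDecomposition

variable {E ι : Type*} [NormedAddCommGroup E] [InnerProductSpace ℝ E] [Fintype ι]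
  {c : ι → ℝ} {u : ι → E}

lemma sum_inner_mul_inner (h : IsUnitDecomposition c u) (x y : E) :
    ∑ i, c i * (inner ℝ (u i) x * inner ℝ (u i) y) = inner ℝ x y := by
  conv_rhs => rw [← h.sum_smul x, sum_inner]
  refine Finset.sum_congr rfl fun i _ => ?_
  rw [real_inner_smul_left]
  ring

lemma sum_inner_sq (h : IsUnitDecomposition c u) (x : E) :
    ∑ i, c i * inner ℝ (u i) x ^ 2 = ‖x‖ ^ 2 := by
  rw [← real_inner_self_eq_norm_sq, ← h.sum_inner_mul_inner]
  simp [sq]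

lemma sum_weights_mul_inner_sq {κ : Type*} [Fintype κ] (h : IsUnitDecomposition c u)
    (b : OrthonormalBasis κ ℝ E) (i : ι) : ∑ k, c i * inner ℝ (u i) (b k) ^ 2 = c i := by
  have h1 := b.sum_sq_norm_inner_left (u i)
  simp only [Real.norm_eq_abs, sq_abs, h.norm_eq_one, one_pow] at h1
  rw [← Finset.mul_sum]
  simp [h1]

lemma sum_weights [FiniteDimensional ℝ E] (h : IsUnitDecomposition c u) :
    ∑ i, c i = Module.finrank ℝ E := by
  let b := stdOrthonormalBasis ℝ E
  calc ∑ i, c i = ∑ i, ∑ k, c i * inner ℝ (u i) (b k) ^ 2 :=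
        Finset.sum_congr rfl fun i _ => (h.sum_weights_mul_inner_sq b i).symm
    _ = ∑ k, ∑ i, c i * inner ℝ (u i) (b k) ^ 2 := Finset.sum_comm
    _ = _ := by simp [h.sum_inner_sq]

/-- The defect in `‖∑ c i • s i • u i‖² ≤ ∑ c i * s i ^ 2`. -/
lemma sum_sq_sub_norm_sq (h : IsUnitDecomposition c u) (s : ι → ℝ) :
    ∑ i, c i * s i ^ 2 - ‖∑ i, (c i * s i) • u i‖ ^ 2
      = ∑ i, c i * (s i - inner ℝ (u i) (∑ j, (c j * s j) • u j)) ^ 2 := by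
  set v := ∑ i, (c i * s i) • u i with hv
  have h1 : ∑ i, c i * (s i * inner ℝ (u i) v) = ‖v‖ ^ 2 := by
    rw [← real_inner_self_eq_norm_sq]
    conv_rhs => rw [hv, sum_inner]
    refine Finset.sum_congr rfl fun i _ => ?_
    rw [real_inner_smul_left]
    ring
  have h2 := h.sum_inner_sq v
  have h3 : ∑ i, c i * (s i - inner ℝ (u i) v) ^ 2 = ∑ i, c i * s i ^ 2
      - 2 * ∑ i, c i * (s i * inner ℝ (u i) v) + ∑ i, c i * inner ℝ (u i) v ^ 2 := by
    rw [Finset.mul_sum, ← Finset.sum_sub_distrib, ← Finset.sum_add_distrib]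
    exact Finset.sum_congr rfl fun i _ => by ring
  rw [h3, h1, h2]
  ring

/-- **Ball's determinant inequality**. -/
lemma exp_sum_le_det [FiniteDimensional ℝ E] (h : IsUnitDecomposition c u) (r : ι → ℝ) :
    Real.exp (∑ i, c i * r i)
      ≤ (∑ i, (c i * Real.exp (r i)) • (innerSL ℝ (u i)).smulRight (u i) : E →L[ℝ] E).det := by
  set T : E →L[ℝ] E := ∑ i, (c i * Real.exp (r i)) • (innerSL ℝ (u i)).smulRight (u i) with hT
  have hTx (x : E) : T x = ∑ i, (c i * Real.exp (r i) * inner ℝ (u i) x) • u i := by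
    simp [hT, smul_smul]
  have hTxy (x y : E) :
      inner ℝ (T x) y = ∑ i, c i * Real.exp (r i) * (inner ℝ (u i) x * inner ℝ (u i) y) := by
    rw [hTx, sum_inner]
    refine Finset.sum_congr rfl fun i _ => ?_
    rw [real_inner_smul_left]
    ring
  have hsym : (T : E →ₗ[ℝ] E).IsSymmetric := fun x y => by
    change inner ℝ (T x) y = inner ℝ x (T y)
    rw [real_inner_comm (T y) x, hTxy, hTxy]
    exact Finset.sum_congr rfl fun i _ => by ring
  let b := hsym.eigenvectorBasis rfl
  have hev (k) : hsym.eigenvalues rfl k = ∑ i, c i * inner ℝ (u i) (b k) ^ 2 * Real.exp (r i) := by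
    have h1 : T (b k) = hsym.eigenvalues rfl k • b k :=
      hsym.apply_eigenvectorBasis rfl k
    have h2 : inner ℝ (T (b k)) (b k) = hsym.eigenvalues rfl k := by
      rw [h1, real_inner_smul_left, real_inner_self_eq_norm_sq, b.norm_eq_one]
      ring
    rw [← h2, hTxy]
    exact Finset.sum_congr rfl fun i _ => by ring
  have hdet : T.det = ∏ k, hsym.eigenvalues rfl k := by
    simpa using hsym.det_eq_prod_eigenvalues rfl
  -- Each eigenvalue is an average of the `exp (r i)` with weights `c i * ⟪u i, b k⟫ ^ 2`, which sum
  -- to 1 over `i`, so Jensen applies. Over `k` the same weights sum to `c i`, which recombines the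
  -- product.
  have hk (k) : Real.exp (∑ i, c i * inner ℝ (u i) (b k) ^ 2 * r i)
      ≤ hsym.eigenvalues rfl k := by
    rw [hev]
    have := convexOn_exp.map_sum_le (t := Finset.univ)
      (w := fun i => c i * inner ℝ (u i) (b k) ^ 2) (p := r)
      (fun i _ => mul_nonneg (h.pos i).le (sq_nonneg _))
      (by rw [h.sum_inner_sq, b.norm_eq_one, one_pow]) (fun i _ => Set.mem_univ _)
    simpa only [smul_eq_mul] using this
  rw [hdet]
  calc Real.exp (∑ i, c i * r i)
      = Real.exp (∑ k, ∑ i, c i * inner ℝ (u i) (b k) ^ 2 * r i) := by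
        rw [Finset.sum_comm]
        congr 1
        refine Finset.sum_congr rfl fun i _ => ?_
        rw [← Finset.sum_mul, h.sum_weights_mul_inner_sq b]
    _ = ∏ k, Real.exp (∑ i, c i * inner ℝ (u i) (b k) ^ 2 * r i) := Real.exp_sum _ _
    _ ≤ _ := Finset.prod_le_prod (fun k _ => (Real.exp_pos _).le) fun k _ => hk k

end IsUnitDecomposition

open Filter Topology Set

/-! ### One-dimensional Gaussian transport -/

/-- The Gaussian mass of the interval `[0, y]`. -/
noncomputable def gaussPrimitive (y : ℝ) : ℝ := ∫ s in (0 : ℝ)..y, gaussianPDFReal 0 1 s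

lemma continuous_gaussianPDFReal : Continuous (gaussianPDFReal 0 1) := by
  unfold gaussianPDFReal
  fun_prop

lemma hasDerivAt_gaussPrimitive (y : ℝ) :
    HasDerivAt gaussPrimitive (gaussianPDFReal 0 1 y) y :=
  (continuous_gaussianPDFReal).integral_hasStrictDerivAt 0 y |>.hasDerivAt

lemma continuous_gaussPrimitive : Continuous gaussPrimitive :=
  continuous_iff_continuousAt.2 fun y => (hasDerivAt_gaussPrimitive y).continuousAt

lemma strictMono_gaussPrimitive : StrictMono gaussPrimitive :=
  strictMono_of_hasDerivAt_pos hasDerivAt_gaussPrimitive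
    fun y => gaussianPDFReal_pos 0 1 y one_ne_zero

lemma gaussPrimitive_zero : gaussPrimitive 0 = 0 := by simp [gaussPrimitive]

lemma gaussPrimitive_neg (y : ℝ) : gaussPrimitive (-y) = -gaussPrimitive y := by
  have h := intervalIntegral.integral_comp_neg (a := 0) (b := y) (gaussianPDFReal 0 1)
  have h2 : ∀ s, gaussianPDFReal 0 1 (-s) = gaussianPDFReal 0 1 s := fun s => by
    simp [gaussianPDFReal]
  simp only [h2, neg_zero] at h
  rw [gaussPrimitive, gaussPrimitive, intervalIntegral.integral_symm, h]

lemma tendsto_gaussPrimitive : Tendsto gaussPrimitive atTop (𝓝 (1 / 2)) := by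
  have h := intervalIntegral_tendsto_integral_Ioi 0
    (integrable_gaussianPDFReal 0 1).integrableOn tendsto_id
  have h1 : ∫ x in Ioi (0 : ℝ), gaussianPDFReal 0 1 x = 1 / 2 := by
    have h2 : ∀ x, gaussianPDFReal 0 1 x = (√(2 * Real.pi))⁻¹ * Real.exp (-(1 / 2) * x ^ 2) := by
      intro x
      simp only [gaussianPDFReal, NNReal.coe_one, mul_one, sub_zero]
      ring_nf
    simp only [h2]
    rw [integral_const_mul, integral_gaussian_Ioi]
    have : Real.pi / (1 / 2) = 2 * Real.pi := by ring
    rw [this]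
    have := Real.sqrt_pos.2 (mul_pos two_pos Real.pi_pos)
    field_simp
  rw [h1] at h
  exact h

lemma gaussPrimitive_lt_half (y : ℝ) : gaussPrimitive y < 1 / 2 :=
  (strictMono_gaussPrimitive (lt_add_one y)).trans_le
    (strictMono_gaussPrimitive.monotone.ge_of_tendsto tendsto_gaussPrimitive _)

lemma exists_gaussPrimitive_eq {p : ℝ} (hp : |p| < 1 / 2) : ∃ y, gaussPrimitive y = p := by
  obtain ⟨y, hy⟩ := (tendsto_gaussPrimitive.eventually_const_lt hp).exists
  have h := abs_lt.1 hy
  have h0 : -y ≤ y := by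
    rw [← strictMono_gaussPrimitive.le_iff_le, gaussPrimitive_neg]
    linarith [abs_nonneg p]
  have := intermediate_value_Icc h0 continuous_gaussPrimitive.continuousOn
  obtain ⟨z, -, hz⟩ := this ⟨by rw [gaussPrimitive_neg]; linarith, h.2.le⟩
  exact ⟨z, hz⟩

/-- The quantile function of the standard Gaussian, centred at zero. -/
noncomputable def gaussQuantile : ℝ → ℝ := Function.invFun gaussPrimitive

lemma gaussPrimitive_gaussQuantile {p : ℝ} (hp : |p| < 1 / 2) :
    gaussPrimitive (gaussQuantile p) = p :=
  Function.invFun_eq (exists_gaussPrimitive_eq hp)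

lemma gaussQuantile_gaussPrimitive (y : ℝ) : gaussQuantile (gaussPrimitive y) = y :=
  Function.leftInverse_invFun strictMono_gaussPrimitive.injective y

lemma abs_gaussPrimitive_lt_half (y : ℝ) : |gaussPrimitive y| < 1 / 2 :=
  abs_lt.2 ⟨by linarith [gaussPrimitive_lt_half (-y), gaussPrimitive_neg y],
    gaussPrimitive_lt_half y⟩

lemma hasDerivAt_gaussQuantile {p : ℝ} (hp : |p| < 1 / 2) :
    HasDerivAt gaussQuantile (gaussianPDFReal 0 1 (gaussQuantile p))⁻¹ p := by
  have hI : {q : ℝ | |q| < 1 / 2} ∈ 𝓝 p := (isOpen_lt continuous_abs continuous_const).mem_nhds hp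
  refine HasDerivAt.of_local_left_inverse ?_ (hasDerivAt_gaussPrimitive _)
    (gaussianPDFReal_pos 0 1 _ one_ne_zero).ne'
    (by filter_upwards [hI] with q hq using gaussPrimitive_gaussQuantile hq)
  -- A monotone function whose image is a neighbourhood of its value is continuous there; here the
  -- image is all of `ℝ`.
  refine continuousAt_of_monotoneOn_of_image_mem_nhds (s := {q : ℝ | |q| < 1 / 2}) ?_ hI ?_
  · intro q hq q' hq' hqq'
    rwa [← strictMono_gaussPrimitive.le_iff_le, gaussPrimitive_gaussQuantile hq,
      gaussPrimitive_gaussQuantile hq']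
  · convert univ_mem
    refine eq_univ_of_forall fun y => ⟨gaussPrimitive y, abs_gaussPrimitive_lt_half y,
      gaussQuantile_gaussPrimitive y⟩

/-- The monotone transport of the standard Gaussian conditioned on `[-t, t]` to the standard
Gaussian. -/
noncomputable def transport (t s : ℝ) : ℝ :=
  gaussQuantile (gaussPrimitive s / (2 * gaussPrimitive t))

lemma gaussPrimitive_pos {t : ℝ} (ht : 0 < t) : 0 < gaussPrimitive t := by
  simpa [gaussPrimitive_zero] using strictMono_gaussPrimitive ht

lemma abs_gaussPrimitive_div_lt {t s : ℝ} (hs : |s| < t) :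
    |gaussPrimitive s / (2 * gaussPrimitive t)| < 1 / 2 := by
  have ht : 0 < gaussPrimitive t := gaussPrimitive_pos ((abs_nonneg s).trans_lt hs)
  have h1 := strictMono_gaussPrimitive (abs_lt.1 hs).1
  have h2 := strictMono_gaussPrimitive (abs_lt.1 hs).2
  rw [gaussPrimitive_neg] at h1
  rw [abs_div, abs_of_pos (by positivity : 0 < 2 * gaussPrimitive t), div_lt_iff₀ (by positivity)]
  have := abs_lt.2 ⟨h1, h2⟩
  linarith

lemma gaussPrimitive_transport {t s : ℝ} (hs : |s| < t) :
    gaussPrimitive (transport t s) = gaussPrimitive s / (2 * gaussPrimitive t) :=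
  gaussPrimitive_gaussQuantile (abs_gaussPrimitive_div_lt hs)

/-- Differentiating `gaussPrimitive (S s) = gaussPrimitive s / a` gives a ratio of Gaussian
densities over `a`. It is kept as a single exponential because `exp_sum_le_det` takes weights of the
form `exp (r i)`. -/
lemma hasDerivAt_transport {t s : ℝ} (hs : |s| < t) :
    HasDerivAt (transport t)
      (Real.exp ((transport t s ^ 2 - s ^ 2) / 2 - Real.log (2 * gaussPrimitive t))) s := by
  have ht : 0 < gaussPrimitive t := gaussPrimitive_pos ((abs_nonneg s).trans_lt hs)
  have h := (hasDerivAt_gaussQuantile (abs_gaussPrimitive_div_lt hs)).comp s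
    ((hasDerivAt_gaussPrimitive s).div_const (2 * gaussPrimitive t))
  refine h.congr_deriv ?_
  change (gaussianPDFReal 0 1 (transport t s))⁻¹ * _ = _
  rw [Real.exp_sub, Real.exp_log (by positivity)]
  simp only [gaussianPDFReal, NNReal.coe_one, mul_one, sub_zero]
  have : (transport t s ^ 2 - s ^ 2) / 2 = -s ^ 2 / 2 - (-transport t s ^ 2 / 2) := by ring
  rw [this, Real.exp_sub]
  have := Real.sqrt_pos.2 (mul_pos two_pos Real.pi_pos)
  field_simp

lemma transport_lt_transport {t s s' : ℝ} (hs : |s| < t) (hs' : |s'| < t) (h : s < s') :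
    transport t s < transport t s' := by
  have ht : 0 < gaussPrimitive t := gaussPrimitive_pos ((abs_nonneg s).trans_lt hs)
  rw [← strictMono_gaussPrimitive.lt_iff_lt, gaussPrimitive_transport hs,
    gaussPrimitive_transport hs']
  exact div_lt_div_of_pos_right (strictMono_gaussPrimitive h) (by positivity)

lemma transport_neg {t s : ℝ} (hs : |s| < t) : transport t (-s) = -transport t s := by
  apply strictMono_gaussPrimitive.injective
  rw [gaussPrimitive_neg, gaussPrimitive_transport hs, gaussPrimitive_transport (by rwa [abs_neg]),
    gaussPrimitive_neg, neg_div]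

/-- The conditioned mass of `[0, s]` tends to `1 / 2`, which the full Gaussian reaches only at
infinity. This blow-up is what makes the equality case rigid. -/
lemma tendsto_transport {t : ℝ} (ht : 0 < t) : Tendsto (transport t) (𝓝[<] t) atTop := by
  have hG := gaussPrimitive_pos ht
  refine tendsto_atTop.2 fun M => ?_
  have h1 : Tendsto (fun s => gaussPrimitive s / (2 * gaussPrimitive t)) (𝓝[<] t) (𝓝 (1 / 2)) := by
    have := (continuous_gaussPrimitive.div_const (2 * gaussPrimitive t)).tendsto t
    have h2 : gaussPrimitive t / (2 * gaussPrimitive t) = 1 / 2 := by field_simp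
    rw [h2] at this
    exact this.mono_left nhdsWithin_le_nhds
  filter_upwards [h1.eventually_const_lt (gaussPrimitive_lt_half M), self_mem_nhdsWithin,
    mem_nhdsWithin_of_mem_nhds (Ioi_mem_nhds (show -t < t by linarith))] with s hs hs1 hs2
  have hst : |s| < t := abs_lt.2 ⟨hs2, hs1⟩
  rw [← gaussPrimitive_transport hst, strictMono_gaussPrimitive.lt_iff_lt] at hs
  exact hs.le

lemma gaussianReal_Icc {t : ℝ} (ht : 0 ≤ t) :
    gaussianReal 0 1 (Icc (-t) t) = ENNReal.ofReal (2 * gaussPrimitive t) := by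
  rw [gaussianReal_apply_eq_integral 0 one_ne_zero, integral_Icc_eq_integral_Ioc,
    ← intervalIntegral.integral_of_le (by linarith)]
  have hi : ∀ a b, IntervalIntegrable (gaussianPDFReal 0 1) volume a b := fun a b =>
    continuous_gaussianPDFReal.intervalIntegrable a b
  rw [← intervalIntegral.integral_add_adjacent_intervals (hi _ 0) (hi _ _),
    intervalIntegral.integral_symm]
  change ENNReal.ofReal (-gaussPrimitive (-t) + gaussPrimitive t) = _
  rw [gaussPrimitive_neg]
  ring_nf

/-! ### The standard Gaussian measure on `ℝⁿ` -/

/-- The density of the standard Gaussian measure on `ℝⁿ`. -/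
noncomputable def gaussDensity (n : ℕ) (x : Euc n) : ℝ :=
  (√(2 * Real.pi))⁻¹ ^ n * Real.exp (-‖x‖ ^ 2 / 2)

lemma gaussDensity_pos (n : ℕ) (x : Euc n) : 0 < gaussDensity n x :=
  mul_pos (pow_pos (inv_pos.2 (Real.sqrt_pos.2 (mul_pos two_pos Real.pi_pos))) n) (Real.exp_pos _)

lemma continuous_gaussDensity (n : ℕ) : Continuous (gaussDensity n) := by
  unfold gaussDensity
  fun_prop

lemma pi_gaussianReal_eq_withDensity (ι : Type*) [Fintype ι] :
    Measure.pi (fun _ : ι => gaussianReal 0 1)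
      = (volume : Measure (ι → ℝ)).withDensity
        fun x => ENNReal.ofReal (∏ i, gaussianPDFReal 0 1 (x i)) := by
  refine Measure.pi_eq fun s hs => ?_
  have hms : MeasurableSet (Set.univ.pi s) := MeasurableSet.univ_pi hs
  have hind (i : ι) : Integrable ((s i).indicator (gaussianPDFReal 0 1)) :=
    (integrable_gaussianPDFReal 0 1).indicator (hs i)
  have hprod (x : ι → ℝ) : (Set.univ.pi s).indicator
      (fun x => ENNReal.ofReal (∏ i, gaussianPDFReal 0 1 (x i))) x
      = ENNReal.ofReal (∏ i, (s i).indicator (gaussianPDFReal 0 1) (x i)) := by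
    by_cases hx : x ∈ Set.univ.pi s
    · rw [Set.indicator_of_mem hx]
      congr 1
      exact Finset.prod_congr rfl fun i _ => (Set.indicator_of_mem (hx i trivial) _).symm
    · rw [Set.indicator_of_notMem hx]
      simp only [Set.mem_pi, Set.mem_univ, true_imp_iff, not_forall] at hx
      obtain ⟨i, hi⟩ := hx
      rw [Finset.prod_eq_zero (Finset.mem_univ i) (Set.indicator_of_notMem hi _),
        ENNReal.ofReal_zero]
  have hnn (i : ι) (y : ℝ) : 0 ≤ (s i).indicator (gaussianPDFReal 0 1) y :=
    Set.indicator_nonneg (fun y _ => gaussianPDFReal_nonneg 0 1 y) y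
  rw [withDensity_apply _ hms, ← lintegral_indicator hms]
  simp only [hprod]
  rw [volume_pi, ← ofReal_integral_eq_lintegral_ofReal (Integrable.fintype_prod hind)
      (ae_of_all _ fun x => Finset.prod_nonneg fun i _ => hnn i _),
    integral_fintype_prod_eq_prod,
    ENNReal.ofReal_prod_of_nonneg fun i _ => integral_nonneg (hnn i)]
  refine Finset.prod_congr rfl fun i _ => ?_
  rw [integral_indicator (hs i), gaussianReal_apply_eq_integral 0 one_ne_zero]

lemma stdGaussian_eq_withDensity (n : ℕ) :
    stdGaussian (Euc n)
      = (volume : Measure (Euc n)).withDensity fun x => ENNReal.ofReal (gaussDensity n x) := by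
  have hmp := PiLp.volume_preserving_toLp (Fin n)
  have hd (x : Fin n → ℝ) :
      gaussDensity n (WithLp.toLp 2 x) = ∏ i, gaussianPDFReal 0 1 (x i) := by
    simp only [gaussDensity, gaussianPDFReal, NNReal.coe_one, mul_one, sub_zero,
      Finset.prod_mul_distrib, ← Real.exp_sum, EuclideanSpace.real_norm_sq_eq]
    simp [Finset.sum_div, neg_div]
  rw [← map_pi_eq_stdGaussian, pi_gaussianReal_eq_withDensity]
  ext A hA
  rw [Measure.map_apply hmp.measurable hA, withDensity_apply _ (hmp.measurable hA),
    withDensity_apply _ hA, ← hmp.setLIntegral_comp_preimage hA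
      (continuous_gaussDensity n).measurable.ennreal_ofReal]
  simp only [hd]

lemma stdGaussian_apply (n : ℕ) {A : Set (Euc n)} (hA : MeasurableSet A) :
    stdGaussian (Euc n) A = ∫⁻ x in A, ENNReal.ofReal (gaussDensity n x) := by
  rw [stdGaussian_eq_withDensity, withDensity_apply _ hA]

lemma stdGaussian_absolutelyContinuous (n : ℕ) : stdGaussian (Euc n) ≪ volume := by
  rw [stdGaussian_eq_withDensity]
  exact withDensity_absolutelyContinuous _ _

lemma stdGaussian_pos_of_isOpen (n : ℕ) {A : Set (Euc n)} (hA : IsOpen A) (hne : A.Nonempty) :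
    0 < stdGaussian (Euc n) A := by
  have h : (volume : Measure (Euc n)) ≪ stdGaussian (Euc n) := by
    rw [stdGaussian_eq_withDensity]
    exact withDensity_absolutelyContinuous'
      (continuous_gaussDensity n).measurable.ennreal_ofReal.aemeasurable
      (ae_of_all _ fun x => (ENNReal.ofReal_pos.2 (gaussDensity_pos n x)).ne')
  rw [pos_iff_ne_zero]
  exact fun h0 => (hA.measure_pos volume hne).ne' (h h0)

lemma stdGaussian_setOf_abs_le (n : ℕ) {t : ℝ} (ht : 0 ≤ t) :
    stdGaussian (Euc n) {x | ∀ i, |x i| ≤ t} = ENNReal.ofReal (2 * gaussPrimitive t) ^ n := by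
  have hm : MeasurableSet {x : Euc n | ∀ i, |x i| ≤ t} := by
    simp only [Set.ofPred_forall]
    exact (isClosed_iInter fun i => isClosed_le (by fun_prop) continuous_const).measurableSet
  have hpre : WithLp.toLp 2 ⁻¹' {x : Euc n | ∀ i, |x i| ≤ t}
      = Set.univ.pi fun _ : Fin n => Set.Icc (-t) t := by
    ext x
    simp only [Set.mem_preimage, Set.mem_ofPred_eq, Set.mem_univ_pi, Set.mem_Icc, abs_le]
  rw [← map_pi_eq_stdGaussian, Measure.map_apply (by fun_prop) hm, hpre, Measure.pi_pi]
  simp [gaussianReal_Icc ht]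

/-! ### Gaussian measure of an intersection of slabs -/

section BrascampLieb

variable {n : ℕ} {ι : Type*} [Fintype ι] {c : ι → ℝ} {u : ι → Euc n}

/-- The open polytope `{x | ∀ i, |⟪u i, x⟫| < t}`. -/
def slabs {n : ℕ} {ι : Type*} (u : ι → Euc n) (t : ℝ) : Set (Euc n) :=
  {x | ∀ i, |inner ℝ (u i) x| < t}

lemma isOpen_slabs (u : ι → Euc n) (t : ℝ) : IsOpen (slabs u t) := by
  simp only [slabs, ofPred_forall]
  exact isOpen_iInter_of_finite fun i => isOpen_lt (by fun_prop) continuous_const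

/-- The transport map `x ↦ ∑ c i • S ⟪u i, x⟫ • u i`. -/
noncomputable def multiTransport (c : ι → ℝ) (u : ι → Euc n) (t : ℝ) (x : Euc n) : Euc n :=
  ∑ i, (c i * transport t (inner ℝ (u i) x)) • u i

/-- The exponent in the derivative of `transport t` at `s`. -/
noncomputable def transportExponent (t s : ℝ) : ℝ :=
  (transport t s ^ 2 - s ^ 2) / 2 - Real.log (2 * gaussPrimitive t)

/-- The derivative of `multiTransport c u t`. -/
noncomputable def multiTransportDeriv (c : ι → ℝ) (u : ι → Euc n) (t : ℝ) (x : Euc n) :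
    Euc n →L[ℝ] Euc n :=
  ∑ i, (c i * Real.exp (transportExponent t (inner ℝ (u i) x))) •
    (innerSL ℝ (u i)).smulRight (u i)

lemma hasFDerivAt_multiTransport {t : ℝ} {x : Euc n} (hx : x ∈ slabs u t) :
    HasFDerivAt (multiTransport c u t) (multiTransportDeriv c u t x) x := by
  refine HasFDerivAt.fun_sum fun i _ => ?_
  have h1 : HasFDerivAt (fun y : Euc n => inner ℝ (u i) y) (innerSL ℝ (u i)) x :=
    (innerSL ℝ (u i)).hasFDerivAt
  have h2 := (((hasDerivAt_transport (hx i)).comp_hasFDerivAt x h1).const_mul (c i)).smul_const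
    (u i)
  refine h2.congr_fderiv ?_
  ext1 y
  simp [transportExponent, smul_smul, mul_assoc]

/-- `⟪Φ x - Φ y, x - y⟫` is a sum of nonnegative terms since `S` is increasing. If it vanishes, all
`⟪u i, x⟫ = ⟪u i, y⟫`, and the decomposition of the identity recovers the point from these numbers.
-/
lemma injOn_multiTransport (h : IsUnitDecomposition c u) (t : ℝ) :
    InjOn (multiTransport c u t) (slabs u t) := by
  intro x hx y hy hxy
  have hterm (i : ι) : 0 ≤ c i * ((transport t (inner ℝ (u i) x) - transport t (inner ℝ (u i) y))
      * (inner ℝ (u i) x - inner ℝ (u i) y)) := by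
    refine mul_nonneg (h.pos i).le ?_
    rcases lt_trichotomy (inner ℝ (u i) x) (inner ℝ (u i) y) with hl | he | hg
    · exact (mul_pos_of_neg_of_neg (sub_neg.2 (transport_lt_transport (hx i) (hy i) hl))
        (sub_neg.2 hl)).le
    · simp [he]
    · exact (mul_pos (sub_pos.2 (transport_lt_transport (hy i) (hx i) hg)) (sub_pos.2 hg)).le
  have hsum : ∑ i, c i * ((transport t (inner ℝ (u i) x) - transport t (inner ℝ (u i) y))
      * (inner ℝ (u i) x - inner ℝ (u i) y)) = 0 := by
    have h0 : inner ℝ (multiTransport c u t x - multiTransport c u t y) (x - y) = 0 := by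
      rw [hxy, sub_self, inner_zero_left]
    rw [← h0, multiTransport, multiTransport, ← Finset.sum_sub_distrib, sum_inner]
    refine Finset.sum_congr rfl fun i _ => ?_
    rw [← sub_smul, real_inner_smul_left, inner_sub_right]
    ring
  have hz (i : ι) : inner ℝ (u i) x = inner ℝ (u i) y := by
    have h1 := (Finset.sum_eq_zero_iff_of_nonneg fun i _ => hterm i).1 hsum i (Finset.mem_univ i)
    by_contra hne
    rcases lt_or_gt_of_ne hne with hl | hg
    · have := mul_pos (h.pos i) (mul_pos_of_neg_of_neg
        (sub_neg.2 (transport_lt_transport (hx i) (hy i) hl)) (sub_neg.2 hl))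
      exact this.ne' h1
    · have := mul_pos (h.pos i) (mul_pos
        (sub_pos.2 (transport_lt_transport (hy i) (hx i) hg)) (sub_pos.2 hg))
      exact this.ne' h1
  rw [← h.sum_smul x, ← h.sum_smul y]
  simp only [hz]

/-- The defect in the quadratic inequality along the transport map. -/
noncomputable def transportDefect (c : ι → ℝ) (u : ι → Euc n) (t : ℝ) (x : Euc n) : ℝ :=
  ∑ i, c i * transport t (inner ℝ (u i) x) ^ 2 - ‖multiTransport c u t x‖ ^ 2

lemma transportDefect_eq (h : IsUnitDecomposition c u) (t : ℝ) (x : Euc n) :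
    transportDefect c u t x = ∑ i, c i * (transport t (inner ℝ (u i) x)
      - inner ℝ (u i) (multiTransport c u t x)) ^ 2 :=
  h.sum_sq_sub_norm_sq fun i => transport t (inner ℝ (u i) x)

lemma transportDefect_nonneg (h : IsUnitDecomposition c u) (t : ℝ) (x : Euc n) :
    0 ≤ transportDefect c u t x := by
  rw [transportDefect_eq h]
  exact Finset.sum_nonneg fun i _ => mul_nonneg (h.pos i).le (sq_nonneg _)

lemma continuousOn_transportDefect (c : ι → ℝ) (u : ι → Euc n) (t : ℝ) :
    ContinuousOn (transportDefect c u t) (slabs u t) := by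
  intro x hx
  refine ContinuousAt.continuousWithinAt ?_
  have h1 (i : ι) : ContinuousAt (fun y => transport t (inner ℝ (u i) y)) x :=
    ContinuousAt.comp (f := fun y => inner ℝ (u i) y) (hasDerivAt_transport (hx i)).continuousAt
      (by fun_prop)
  have h2 : ContinuousAt (multiTransport c u t) x :=
    (hasFDerivAt_multiTransport hx).continuousAt
  exact (tendsto_finsetSum _ fun i _ => ((h1 i).pow 2).const_mul (c i)).sub (h2.norm.pow 2)

/-- In Ball's bound, `∑ c i = n` turns the logarithms into the factor `a ^ n`, and `∑ c i * ⟪u i, x⟫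
^ 2 = ‖x‖ ^ 2` produces the Gaussian density. The factor with the defect is not discarded: it
decides the equality case. -/
lemma gaussDensity_mul_exp_le (h : IsUnitDecomposition c u) {t : ℝ} (ht : 0 < t) (x : Euc n) :
    gaussDensity n x * Real.exp (transportDefect c u t x / 2)
      ≤ (2 * gaussPrimitive t) ^ n *
        ((multiTransportDeriv c u t x).det * gaussDensity n (multiTransport c u t x)) := by
  have ha : 0 < 2 * gaussPrimitive t := mul_pos two_pos (gaussPrimitive_pos ht)
  have hdet := h.exp_sum_le_det fun i => transportExponent t (inner ℝ (u i) x)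
  have hsum : ∑ i, c i * transportExponent t (inner ℝ (u i) x)
      = (transportDefect c u t x + ‖multiTransport c u t x‖ ^ 2 - ‖x‖ ^ 2) / 2
        - n * Real.log (2 * gaussPrimitive t) := by
    have hw := h.sum_weights
    rw [finrank_euclideanSpace_fin] at hw
    rw [transportDefect, ← h.sum_inner_sq x, ← hw, sub_add_cancel, ← Finset.sum_sub_distrib,
      Finset.sum_div, Finset.sum_mul, ← Finset.sum_sub_distrib]
    refine Finset.sum_congr rfl fun i _ => ?_
    rw [transportExponent]
    ring
  have hexp : (2 * gaussPrimitive t) ^ n * Real.exp (∑ i, c i *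
      transportExponent t (inner ℝ (u i) x)) * Real.exp (-‖multiTransport c u t x‖ ^ 2 / 2)
      = Real.exp (-‖x‖ ^ 2 / 2) * Real.exp (transportDefect c u t x / 2) := by
    have : (2 * gaussPrimitive t) ^ n = Real.exp (n * Real.log (2 * gaussPrimitive t)) := by
      rw [Real.exp_nat_mul, Real.exp_log ha]
    rw [this, ← Real.exp_add, ← Real.exp_add, ← Real.exp_add, hsum]
    congr 1
    ring
  have hC : 0 ≤ (√(2 * Real.pi))⁻¹ ^ n := by positivity
  calc gaussDensity n x * Real.exp (transportDefect c u t x / 2)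
      = (√(2 * Real.pi))⁻¹ ^ n *
          (Real.exp (-‖x‖ ^ 2 / 2) * Real.exp (transportDefect c u t x / 2)) := by
        rw [gaussDensity, mul_assoc]
    _ = (2 * gaussPrimitive t) ^ n * (Real.exp (∑ i, c i *
          transportExponent t (inner ℝ (u i) x)) * gaussDensity n (multiTransport c u t x)) := by
        rw [← hexp, gaussDensity]
        ring
    _ ≤ _ := by
        gcongr
        · exact (gaussDensity_pos _ _).le
        · exact hdet

/-- The pointwise bound integrates by change of variables; only injectivity of the transport is
needed, since the image has Gaussian measure at most 1 in any case. -/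
lemma lintegral_gaussDensity_mul_exp_le (h : IsUnitDecomposition c u) {t : ℝ} (ht : 0 < t) :
    ∫⁻ x in slabs u t, ENNReal.ofReal
        (gaussDensity n x * Real.exp (transportDefect c u t x / 2))
      ≤ ENNReal.ofReal (2 * gaussPrimitive t) ^ n := by
  have ha : 0 < 2 * gaussPrimitive t := mul_pos two_pos (gaussPrimitive_pos ht)
  have hcv := lintegral_image_eq_lintegral_abs_det_fderiv_mul volume
    (isOpen_slabs u t).measurableSet
    (fun x hx => (hasFDerivAt_multiTransport (c := c) hx).hasFDerivWithinAt)
    (injOn_multiTransport h t) fun x => ENNReal.ofReal (gaussDensity n x)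
  have htot : ∫⁻ x in multiTransport c u t '' slabs u t, ENNReal.ofReal (gaussDensity n x) ≤ 1 := by
    refine (setLIntegral_le_lintegral _ _).trans ?_
    rw [← setLIntegral_univ, ← stdGaussian_apply n MeasurableSet.univ, measure_univ]
  calc _ ≤ ∫⁻ x in slabs u t, ENNReal.ofReal (2 * gaussPrimitive t) ^ n *
        (ENNReal.ofReal |(multiTransportDeriv c u t x).det| *
          ENNReal.ofReal (gaussDensity n (multiTransport c u t x))) := by
        refine lintegral_mono fun x => ?_
        rw [← ENNReal.ofReal_pow ha.le, ← ENNReal.ofReal_mul (abs_nonneg _),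
          ← ENNReal.ofReal_mul (by positivity)]
        refine ENNReal.ofReal_le_ofReal ((gaussDensity_mul_exp_le h ht x).trans ?_)
        gcongr
        · exact (gaussDensity_pos _ _).le
        · exact le_abs_self _
    _ = ENNReal.ofReal (2 * gaussPrimitive t) ^ n *
        ∫⁻ x in multiTransport c u t '' slabs u t, ENNReal.ofReal (gaussDensity n x) := by
        rw [lintegral_const_mul' _ _ (by finiteness), hcv]
    _ ≤ _ := mul_le_of_le_one_right' htot

lemma stdGaussian_slabs_le (h : IsUnitDecomposition c u) {t : ℝ} (ht : 0 < t) :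
    stdGaussian (Euc n) (slabs u t) ≤ ENNReal.ofReal (2 * gaussPrimitive t) ^ n := by
  rw [stdGaussian_apply n (isOpen_slabs u t).measurableSet]
  refine (lintegral_mono fun x => ENNReal.ofReal_le_ofReal ?_).trans
    (lintegral_gaussDensity_mul_exp_le h ht)
  refine le_mul_of_one_le_right (gaussDensity_pos n x).le (Real.one_le_exp ?_)
  exact div_nonneg (transportDefect_nonneg h t x) two_pos.le

/-- Equality makes the integrals with and without the factor `exp (defect / 2) ≥ 1` equal and
finite, so the integrands agree almost everywhere, and by continuity everywhere on the open set. -/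
lemma transportDefect_eq_zero (h : IsUnitDecomposition c u) {t : ℝ} (ht : 0 < t)
    (heq : stdGaussian (Euc n) (slabs u t) = ENNReal.ofReal (2 * gaussPrimitive t) ^ n)
    {x : Euc n} (hx : x ∈ slabs u t) : transportDefect c u t x = 0 := by
  have hle (x : Euc n) : gaussDensity n x
      ≤ gaussDensity n x * Real.exp (transportDefect c u t x / 2) :=
    le_mul_of_one_le_right (gaussDensity_pos n x).le
      (Real.one_le_exp (div_nonneg (transportDefect_nonneg h t x) two_pos.le))
  have hcont : ContinuousOn (fun x => gaussDensity n x * Real.exp (transportDefect c u t x / 2))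
      (slabs u t) :=
    (continuous_gaussDensity n).continuousOn.mul
      ((continuousOn_transportDefect c u t).div_const 2).rexp
  have hae := ae_eq_of_ae_le_of_lintegral_le
    (μ := (volume : Measure (Euc n)).restrict (slabs u t))
    (f := fun x => ENNReal.ofReal (gaussDensity n x))
    (g := fun x => ENNReal.ofReal (gaussDensity n x * Real.exp (transportDefect c u t x / 2)))
    (ae_of_all _ fun x => ENNReal.ofReal_le_ofReal (hle x))
    (by
      rw [← stdGaussian_apply n (isOpen_slabs u t).measurableSet]
      exact measure_ne_top _ _)
    (hcont.aemeasurable (isOpen_slabs u t).measurableSet).ennreal_ofReal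
    (by
      rw [← stdGaussian_apply n (isOpen_slabs u t).measurableSet, heq]
      exact lintegral_gaussDensity_mul_exp_le h ht)
  have hae' : gaussDensity n =ᵐ[(volume : Measure (Euc n)).restrict (slabs u t)]
      fun x => gaussDensity n x * Real.exp (transportDefect c u t x / 2) := by
    filter_upwards [hae] with y hy
    exact (ENNReal.ofReal_eq_ofReal_iff (gaussDensity_pos n y).le
      ((gaussDensity_pos n y).le.trans (hle y))).1 hy
  have := Measure.eqOn_open_of_ae_eq hae' (isOpen_slabs u t)
    (continuous_gaussDensity n).continuousOn hcont hx
  have h1 := (mul_eq_left₀ (gaussDensity_pos n x).ne').1 this.symm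
  rw [Real.exp_eq_one_iff] at h1
  linarith

/-- Along `s • u j`, zero defect gives `S s = ∑ c i * r i * S (s * r i)` with `r i = ⟪u i, u j⟫`.
Dividing by `S s` and letting `s → t` leaves only the terms with `|r i| = 1`, whose weights
therefore sum to 1. As also `∑ c i * r i ^ 2 = 1`, every other `r i` is zero. -/
lemma inner_eq_zero_or_abs_eq_one (h : IsUnitDecomposition c u) {t : ℝ} (ht : 0 < t)
    (heq : stdGaussian (Euc n) (slabs u t) = ENNReal.ofReal (2 * gaussPrimitive t) ^ n)
    (i j : ι) : inner ℝ (u i) (u j) = 0 ∨ |inner ℝ (u i) (u j)| = 1 := by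
  have hr (i : ι) : |inner ℝ (u i) (u j)| ≤ 1 := by
    simpa [h.norm_eq_one] using abs_real_inner_le_norm (u i) (u j)
  have hrj : inner ℝ (u j) (u j) = (1 : ℝ) := by
    rw [real_inner_self_eq_norm_sq, h.norm_eq_one, one_pow]
  have hmem {s : ℝ} (hs : |s| < t) : s • u j ∈ slabs u t := fun i => by
    rw [real_inner_smul_right, abs_mul]
    exact (mul_le_of_le_one_right (abs_nonneg s) (hr i)).trans_lt hs
  have hid {s : ℝ} (hs : |s| < t) : transport t s
      = ∑ i, c i * inner ℝ (u i) (u j) * transport t (s * inner ℝ (u i) (u j)) := by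
    have h0 := transportDefect_eq_zero h ht heq (hmem hs)
    rw [transportDefect_eq h, Finset.sum_eq_zero_iff_of_nonneg
      fun i _ => mul_nonneg (h.pos i).le (sq_nonneg _)] at h0
    have h1 := h0 j (Finset.mem_univ j)
    rw [mul_eq_zero, or_iff_right (h.pos j).ne', sq_eq_zero_iff, sub_eq_zero,
      real_inner_smul_right, hrj, mul_one, multiTransport, inner_sum] at h1
    rw [h1]
    refine Finset.sum_congr rfl fun i _ => ?_
    rw [real_inner_smul_right, real_inner_smul_right, real_inner_comm (u i) (u j)]
    ring
  have hnear : ∀ᶠ s in 𝓝[<] t, |s| < t := by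
    filter_upwards [self_mem_nhdsWithin,
      mem_nhdsWithin_of_mem_nhds (Ioi_mem_nhds (show -t < t by linarith))] with s hs1 hs2
    exact abs_lt.2 ⟨hs2, hs1⟩
  have hpos : ∀ᶠ s in 𝓝[<] t, 0 < transport t s :=
    (tendsto_transport ht).eventually_gt_atTop 0
  have hlim (i : ι) : Tendsto (fun s => c i * inner ℝ (u i) (u j) *
      transport t (s * inner ℝ (u i) (u j)) / transport t s) (𝓝[<] t)
      (𝓝 (c i * if |inner ℝ (u i) (u j)| = 1 then 1 else 0)) := by
    split_ifs with h1
    · refine tendsto_const_nhds.congr' ?_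
      filter_upwards [hnear, hpos] with s hs hs0
      rcases eq_or_eq_neg_of_abs_eq h1 with h2 | h2
      · rw [h2]
        field_simp
      · rw [h2, mul_neg_one, mul_neg_one, transport_neg hs]
        field_simp
    · rw [mul_zero]
      have hlt : |inner ℝ (u i) (u j)| < 1 := lt_of_le_of_ne (hr i) h1
      have hc : ContinuousAt (fun s => c i * inner ℝ (u i) (u j) *
          transport t (s * inner ℝ (u i) (u j))) t := by
        refine continuousAt_const.mul (ContinuousAt.comp
          (f := fun s => s * inner ℝ (u i) (u j)) (hasDerivAt_transport ?_).continuousAt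
          (by fun_prop))
        rw [abs_mul, abs_of_pos ht]
        exact mul_lt_of_lt_one_right ht hlt
      exact (hc.tendsto.mono_left nhdsWithin_le_nhds).div_atTop (tendsto_transport ht)
  have hone : (1 : ℝ) = ∑ i, c i * if |inner ℝ (u i) (u j)| = 1 then 1 else 0 := by
    refine tendsto_nhds_unique ?_ (tendsto_finsetSum Finset.univ fun i _ => hlim i)
    refine tendsto_const_nhds.congr' ?_
    filter_upwards [hnear, hpos] with s hs hs0
    rw [← Finset.sum_div, ← hid hs, div_self hs0.ne']
  have hsq := h.sum_inner_sq (u j)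
  rw [h.norm_eq_one, one_pow, hone, ← sub_eq_zero, ← neg_eq_zero, neg_sub,
    ← Finset.sum_sub_distrib] at hsq
  by_contra! hcon
  have key : ∀ i ∈ Finset.univ, c i * (if |inner ℝ (u i) (u j)| = 1 then 1 else 0)
      - c i * inner ℝ (u i) (u j) ^ 2 ≤ 0 := fun i _ => by
    split_ifs with h1
    · rw [← sq_abs, h1]
      simp
    · nlinarith [h.pos i, sq_nonneg (inner ℝ (u i) (u j)),
        mul_nonneg (h.pos i).le (sq_nonneg (inner ℝ (u i) (u j)))]
  have h3 := (Finset.sum_eq_zero_iff_of_nonpos key).1 hsq i (Finset.mem_univ i)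
  rw [if_neg hcon.2, mul_zero, zero_sub, neg_eq_zero, mul_eq_zero, or_iff_right (h.pos i).ne',
    sq_eq_zero_iff] at h3
  exact hcon.1 h3

end BrascampLieb

/-! ### John's theorem -/

/-- In finite dimension, the convex hull of a compact set is compact. -/
lemma isCompact_convexHull {F : Type*} [NormedAddCommGroup F] [NormedSpace ℝ F]
    [FiniteDimensional ℝ F] {s : Set F} (hs : IsCompact s) : IsCompact (convexHull ℝ s) := by
  rcases s.eq_empty_or_nonempty with rfl | ⟨z₀, hz₀⟩
  · simp
  -- Carathéodory's bound on the number of points; shorter combinations are padded by `z₀` with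
  -- weight zero.
  let N := Module.finrank ℝ F + 1
  let f : (Fin N → ℝ) × (Fin N → F) → F := fun p => ∑ k, p.1 k • p.2 k
  have hf : Continuous f := by fun_prop
  have hc : IsCompact (stdSimplex ℝ (Fin N) ×ˢ univ.pi fun _ : Fin N => s) :=
    (isCompact_stdSimplex ℝ _).prod (isCompact_univ_pi fun _ => hs)
  convert hc.image hf
  refine Subset.antisymm (fun x hx => ?_) ?_
  · obtain ⟨ι, _, z, w, hz, haff, hw, hw1, rfl⟩ := eq_pos_convex_span_of_mem_convexHull hx
    have hcard : Fintype.card ι ≤ Fintype.card (Fin N) := by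
      rw [Fintype.card_fin]
      exact haff.card_le_finrank_succ.trans (Nat.succ_le_succ (Submodule.finrank_le _))
    obtain ⟨e⟩ := Function.Embedding.nonempty_of_card_le hcard
    have he := e.injective
    have hext (k : Fin N) (hk : k ∉ range e) : Function.extend e w 0 k = 0 :=
      Function.extend_apply' _ _ _ hk
    refine ⟨(Function.extend e w 0, Function.extend e z fun _ => z₀), ⟨⟨fun k => ?_, ?_⟩, ?_⟩, ?_⟩
    · by_cases hk : k ∈ range e
      · obtain ⟨i, rfl⟩ := hk
        simpa [he.extend_apply] using (hw i).le
      · exact (hext k hk).ge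
    · rw [← hw1]
      exact (Fintype.sum_of_injective e he _ _ hext fun i => (he.extend_apply w 0 i).symm).symm
    · intro k _
      by_cases hk : k ∈ range e
      · obtain ⟨i, rfl⟩ := hk
        simpa [he.extend_apply] using hz (mem_range_self i)
      · simpa [Function.extend_apply' _ _ _ hk] using hz₀
    · refine (Fintype.sum_of_injective e he _ _ (fun k hk => ?_) fun i => ?_).symm
      · simp [hext k hk]
      · simp [he.extend_apply]
  · rintro _ ⟨⟨w, z⟩, ⟨⟨hw0, hw1⟩, hz⟩, rfl⟩
    exact (convex_convexHull ℝ s).sum_mem (fun k _ => hw0 k) hw1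
      fun k hk => subset_convexHull ℝ s (hz k (mem_univ k))

variable {n : ℕ}

/-- The unit vectors `u` such that `K` lies in the half-space `{x | ⟪u, x⟫ ≤ 1}`. -/
def contactSet (K : Set (Euc n)) : Set (Euc n) := {u | ‖u‖ = 1 ∧ ∀ x ∈ K, inner ℝ u x ≤ 1}

lemma isCompact_contactSet (K : Set (Euc n)) : IsCompact (contactSet K) := by
  refine (isCompact_sphere (0 : Euc n) 1).of_isClosed_subset ?_ fun u hu => by simpa using hu.1
  have : contactSet K = {u | ‖u‖ = 1} ∩ ⋂ x ∈ K, {u | inner ℝ u x ≤ 1} := by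
    ext u
    simp [contactSet]
  rw [this]
  exact (isClosed_eq continuous_norm continuous_const).inter
    (isClosed_biInter fun x _ => isClosed_le (by fun_prop) continuous_const)

/-- A small linear perturbation of the unit ball stays in `K` if it shrinks the ball at all
contact directions. -/
lemma eventually_image_unitBall_subset {K : Set (Euc n)} (hconv : Convex ℝ K) (hcl : IsClosed K)
    (hball : unitBall n ⊆ K) (B : Euc n →L[ℝ] Euc n)
    (hB : ∀ u ∈ contactSet K, inner ℝ (B u) u < 0) :
    ∀ᶠ δ : ℝ in 𝓝[>] 0, ∀ y ∈ unitBall n, y + δ • B y ∈ K := by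
  -- The support function of the perturbed ball at `w` is `‖w + δ • A w‖`, to be compared with that
  -- of `K`. At a contact direction `w₀` the point `w` itself serves as `x` for `w` near `w₀`, as
  -- the norm falls below 1 to first order; at other directions some `x ∈ K` has `⟪w₀, x⟫ > 1`, an
  -- open condition. Compactness of the sphere makes `δ` uniform.
  let A := ContinuousLinearMap.adjoint B
  have hloc : ∀ w₀ ∈ Metric.sphere (0 : Euc n) 1, ∀ᶠ p : ℝ × Euc n in 𝓝 (0, w₀),
      0 < p.1 → ‖p.2‖ = 1 → ∃ x ∈ K, ‖p.2 + p.1 • A p.2‖ ≤ inner ℝ p.2 x := by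
    intro w₀ hw₀
    have hw₀1 : ‖w₀‖ = 1 := by simpa using hw₀
    by_cases hc : w₀ ∈ contactSet K
    · have hcont : Continuous fun p : ℝ × Euc n =>
          2 * inner ℝ p.2 (A p.2) + p.1 * ‖A p.2‖ ^ 2 := by fun_prop
      have hneg : 2 * inner ℝ w₀ (A w₀) + 0 * ‖A w₀‖ ^ 2 < 0 := by
        rw [ContinuousLinearMap.adjoint_inner_right]
        linarith [hB w₀ hc]
      filter_upwards [hcont.continuousAt.eventually_lt_const hneg] with p hp hp0 hp1
      refine ⟨p.2, hball (by simp [unitBall, hp1]), ?_⟩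
      rw [real_inner_self_eq_norm_sq, hp1, one_pow, ← sq_le_one_iff₀ (norm_nonneg _),
        norm_add_sq_real, norm_smul, real_inner_smul_right, hp1, mul_pow, Real.norm_eq_abs, sq_abs]
      nlinarith
    · obtain ⟨x, hx, hx1⟩ : ∃ x ∈ K, 1 < inner ℝ w₀ x := by
        simpa [contactSet, hw₀1] using hc
      have hcont : Continuous fun p : ℝ × Euc n => ‖p.2 + p.1 • A p.2‖ - inner ℝ p.2 x := by
        fun_prop
      have hneg : ‖w₀ + (0 : ℝ) • A w₀‖ - inner ℝ w₀ x < 0 := by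
        rw [zero_smul, add_zero, hw₀1]
        linarith
      filter_upwards [hcont.continuousAt.eventually_lt_const hneg] with p hp _ _
      exact ⟨x, hx, by linarith⟩
  have hall := (isCompact_sphere (0 : Euc n) 1).eventually_forall_of_forall_eventually
    (P := fun δ w => 0 < δ → ‖w‖ = 1 → ∃ x ∈ K, ‖w + δ • A w‖ ≤ inner ℝ w x) hloc
  filter_upwards [mem_nhdsWithin_of_mem_nhds hall, self_mem_nhdsWithin] with δ hδ hδ0 y hy
  by_contra hyK
  obtain ⟨f, v, hfK, hfy⟩ := geometric_hahn_banach_closed_point hconv hcl hyK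
  set w := (InnerProductSpace.toDual ℝ (Euc n)).symm f with hw
  have hfw (z : Euc n) : f z = inner ℝ w z := by
    rw [hw, InnerProductSpace.toDual_symm_apply]
  have h0 : (0 : Euc n) ∈ K := hball (by simp [unitBall])
  have hv : 0 < v := by simpa using hfK 0 h0
  have hwne : w ≠ 0 := fun h => by
    rw [hfw, h, inner_zero_left] at hfy
    linarith
  have hwpos : 0 < ‖w‖ := norm_pos_iff.2 hwne
  have hnorm : ‖‖w‖⁻¹ • w‖ = 1 := by
    rw [norm_smul, norm_inv, norm_norm, inv_mul_cancel₀ hwpos.ne']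
  obtain ⟨x, hxK, hx⟩ := hδ (‖w‖⁻¹ • w) (by simpa using hnorm) hδ0 hnorm
  rw [map_smul, smul_comm, ← smul_add, norm_smul, norm_inv, norm_norm, real_inner_smul_left] at hx
  have hx' : ‖w + δ • A w‖ ≤ inner ℝ w x := le_of_mul_le_mul_left hx (inv_pos.2 hwpos)
  have hy1 : ‖y‖ ≤ 1 := by simpa [unitBall] using hy
  have : f (y + δ • B y) ≤ f x := by
    rw [hfw, hfw]
    calc inner ℝ w (y + δ • B y) = inner ℝ (w + δ • A w) y := by
          rw [inner_add_left, inner_add_right, real_inner_smul_left, real_inner_smul_right,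
            ContinuousLinearMap.adjoint_inner_left]
      _ ≤ ‖w + δ • A w‖ * ‖y‖ := real_inner_le_norm _ _
      _ ≤ ‖w + δ • A w‖ := mul_le_of_le_one_right (norm_nonneg _) hy1
      _ ≤ _ := hx'
  linarith [hfK x hxK]

/-- The determinant is `1 + δ * M.trace + O(δ ^ 2)`. -/
lemma eventually_one_lt_det {M : Matrix (Fin n) (Fin n) ℝ} (hM : 0 < M.trace) :
    ∀ᶠ δ : ℝ in 𝓝[>] 0, 1 < (1 + δ • M).det := by
  set P := (1 + (Polynomial.X : Polynomial ℝ) • M.map Polynomial.C).det.divX.divX with hP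
  have hcont : Continuous fun δ : ℝ => M.trace + P.eval δ * δ := by fun_prop
  have h0 : 0 < M.trace + P.eval 0 * 0 := by simpa using hM
  filter_upwards [mem_nhdsWithin_of_mem_nhds (hcont.continuousAt.eventually_const_lt h0),
    self_mem_nhdsWithin] with δ hδ hδ0
  rw [Matrix.det_one_add_smul, ← hP]
  nlinarith [mul_pos hδ hδ0]

/-- If the unit ball has maximal volume among the ellipsoids in `K`, then no traceful linear map
contracts at all contact directions. -/
lemma exists_contactSet_inner_nonneg {K : Set (Euc n)} (hconv : Convex ℝ K) (hcl : IsClosed K)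
    (hJohn : IsMaxVolumeEllipsoid (unitBall n) K) {M : Matrix (Fin n) (Fin n) ℝ}
    (hM : 0 < M.trace) : ∃ u ∈ contactSet K, 0 ≤ ∑ i, ∑ j, M i j * (u i * u j) := by
  by_contra! hcon
  let b := (EuclideanSpace.basisFun (Fin n) ℝ).toBasis
  let B : Euc n →L[ℝ] Euc n := LinearMap.toContinuousLinearMap (Matrix.toLin b b M)
  have hBu (u : Euc n) : inner ℝ (B u) u = ∑ i, ∑ j, M i j * (u i * u j) := by
    have hBi (i : Fin n) : B u i = ∑ j, M i j * u j := by
      have h1 : (Matrix.toLin b b M) u = WithLp.toLp 2 (M.mulVec u) := by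
        simp [b, Matrix.toLin_apply, Matrix.mulVec, dotProduct]
        ext i
        simp [Finset.sum_apply, Pi.single_apply, dotProduct, Matrix.mulVec]
      change (Matrix.toLin b b M) u i = _
      rw [h1]
      rfl
    rw [PiLp.inner_apply]
    refine Finset.sum_congr rfl fun i _ => ?_
    rw [hBi, real_inner_comm]
    simp only [RCLike.inner_apply, conj_trivial, Finset.sum_mul]
    exact Finset.sum_congr rfl fun j _ => by ring
  have hsub := eventually_image_unitBall_subset hconv hcl hJohn.2.1 B
    fun u hu => by rw [hBu]; exact hcon u hu
  obtain ⟨δ, hδ, hdet⟩ := (hsub.and (eventually_one_lt_det hM)).exists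
  have hdetT : LinearMap.det (Matrix.toLin b b (1 + δ • M)) = (1 + δ • M).det :=
    LinearMap.det_toLin b _
  have hT (y : Euc n) : Matrix.toLin b b (1 + δ • M) y = y + δ • B y := by
    rw [map_add, map_smul, Matrix.toLin_one]
    rfl
  have hne : LinearMap.det (Matrix.toLin b b (1 + δ • M)) ≠ 0 := by
    rw [hdetT]
    linarith
  let e : Euc n ≃ₗ[ℝ] Euc n := LinearEquiv.ofIsUnitDet (f := Matrix.toLin b b (1 + δ • M))
    (v := b) (v' := b) (by
      rw [LinearMap.toMatrix_toLin]
      exact (by linarith : (1 + δ • M).det ≠ 0).isUnit)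
  have he (y : Euc n) : e y = Matrix.toLin b b (1 + δ • M) y := rfl
  have hmax := hJohn.2.2 (e.toAffineEquiv '' unitBall n) ⟨_, rfl⟩ (by
    rintro _ ⟨y, hy, rfl⟩
    change e y ∈ K
    rw [he, hT]
    exact hδ y hy)
  have himg : e.toAffineEquiv '' unitBall n = Matrix.toLin b b (1 + δ • M) '' unitBall n := rfl
  rw [himg, Measure.addHaar_image_linearMap, hdetT] at hmax
  have hpos : 0 < volume (unitBall n) := Metric.measure_closedBall_pos _ _ one_pos
  have hfin : volume (unitBall n) ≠ ∞ := measure_closedBall_lt_top.ne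
  have hlt : 1 * volume (unitBall n) < ENNReal.ofReal |(1 + δ • M).det| * volume (unitBall n) := by
    refine ENNReal.mul_lt_mul_left hpos.ne' hfin ?_
    rw [← ENNReal.ofReal_one]
    exact (ENNReal.ofReal_lt_ofReal_iff (by positivity)).2 (hdet.trans_le (le_abs_self _))
  rw [one_mul] at hlt
  exact hlt.not_ge hmax

/-- **John's theorem**: if the unit ball has maximal volume among the ellipsoids in `K`, then the
identity decomposes over contact directions. -/
theorem exists_isUnitDecomposition {K : Set (Euc n)} (hn : n ≠ 0) (hconv : Convex ℝ K)
    (hcl : IsClosed K) (hJohn : IsMaxVolumeEllipsoid (unitBall n) K) :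
    ∃ (ι : Type) (_ : Fintype ι) (c : ι → ℝ) (u : ι → Euc n),
      IsUnitDecomposition c u ∧ ∀ i, ∀ x ∈ K, inner ℝ (u i) x ≤ 1 := by
  have hn0 : (0 : ℝ) < n := by exact_mod_cast Nat.pos_of_ne_zero hn
  let outer : Euc n → Fin n → Fin n → ℝ := fun u i j => u i * u j
  have houter : Continuous outer := by fun_prop
  -- The identity divided by `n`: like each `u ⊗ u` it has trace 1, so it can be a convex
  -- combination of them.
  let p : Fin n → Fin n → ℝ := fun i j => if i = j then (n : ℝ)⁻¹ else 0
  have hp : p ∈ convexHull ℝ (outer '' contactSet K) := by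
    by_contra hp
    obtain ⟨f, v, hf, hfp⟩ := geometric_hahn_banach_closed_point (convex_convexHull ℝ _)
      (isCompact_convexHull ((isCompact_contactSet K).image houter)).isClosed hp
    have hfsum (m : Fin n → Fin n → ℝ) :
        f m = ∑ i, ∑ j, m i j * f (Pi.single i (Pi.single j 1)) := by
      have hm : m = ∑ i, ∑ j, m i j • (Pi.single i (Pi.single j (1 : ℝ)) : Fin n → Fin n → ℝ) := by
        ext k l
        simp [Finset.sum_apply, Pi.single_apply, apply_ite, ite_apply]
      conv_lhs => rw [hm]
      simp
    -- The separating functional minus `v` times the identity: its quadratic form is `f (outer u) -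
    -- v < 0` on contact directions, while its trace is `n * (f p - v) > 0`.
    let M : Matrix (Fin n) (Fin n) ℝ := Matrix.of fun i j =>
      f (Pi.single i (Pi.single j 1)) - if i = j then v else 0
    have htr : 0 < M.trace := by
      have h1 : f p = (n : ℝ)⁻¹ * ∑ i, f (Pi.single i (Pi.single i 1)) := by
        rw [hfsum, Finset.mul_sum]
        simp [p]
      have h2 : M.trace = n * (f p - v) := by
        rw [h1]
        simp only [Matrix.trace, Matrix.diag, M, Matrix.of_apply, if_true, Finset.sum_sub_distrib,
          Finset.sum_const, Finset.card_univ, Fintype.card_fin, nsmul_eq_mul]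
        field_simp
      rw [h2]
      exact mul_pos hn0 (sub_pos.2 hfp)
    obtain ⟨u, hu, hu0⟩ := exists_contactSet_inner_nonneg hconv hcl hJohn htr
    have h1 : ∑ i, ∑ j, M i j * (u i * u j) = f (outer u) - v * ‖u‖ ^ 2 := by
      rw [hfsum, EuclideanSpace.real_norm_sq_eq, Finset.mul_sum, ← Finset.sum_sub_distrib]
      refine Finset.sum_congr rfl fun i _ => ?_
      simp only [M, Matrix.of_apply, sub_mul, Finset.sum_sub_distrib, ite_mul, zero_mul,
        Finset.sum_ite_eq, Finset.mem_univ, if_true]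
      congr 1
      · exact Finset.sum_congr rfl fun j _ => mul_comm _ _
      · ring
    rw [h1, hu.1] at hu0
    linarith [hf _ (subset_convexHull ℝ _ (mem_image_of_mem outer hu))]
  obtain ⟨ι, _, z, w, hz, -, hw, -, hsum⟩ := eq_pos_convex_span_of_mem_convexHull hp
  choose u hu huz using fun k => hz (mem_range_self k)
  refine ⟨ι, inferInstance, fun k => n * w k, u, ⟨fun k => mul_pos hn0 (hw k), fun k => (hu k).1,
    fun x => ?_⟩, fun k => (hu k).2⟩
  have hij (i j : Fin n) : ∑ k, w k * (u k i * u k j) = p i j := by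
    rw [← hsum]
    simp only [Finset.sum_apply, Pi.smul_apply, smul_eq_mul, ← huz]
    rfl
  ext i
  have h1 : (∑ k, (n * w k * inner ℝ (u k) x) • u k) i
      = ∑ j, n * x j * ∑ k, w k * (u k i * u k j) := by
    simp only [WithLp.ofLp_sum, WithLp.ofLp_smul, Finset.sum_apply, Pi.smul_apply, smul_eq_mul,
      PiLp.inner_apply, RCLike.inner_apply, conj_trivial, Finset.mul_sum, Finset.sum_mul]
    rw [Finset.sum_comm]
    exact Finset.sum_congr rfl fun j _ => Finset.sum_congr rfl fun k _ => by ring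
  rw [h1]
  simp only [hij, p, mul_ite, mul_zero, Finset.sum_ite_eq, Finset.mem_univ, if_true]
  field_simp

/-! ### Radial functions, cubes and orthonormal bases -/

/-- The supremum defining `radial` need not be known to be attained: if it is at least `t⁻¹`,
convexity puts `r • x` in `K` for all `0 < r < t⁻¹`, and closedness gives the endpoint. -/
lemma setOf_lt_inv_radial {K : Set (Euc n)} (hconv : Convex ℝ K) (hcl : IsClosed K)
    (h0 : (0 : Euc n) ∈ K) {t : ℝ} (ht : 0 < t) :
    {x | (radial K x)⁻¹ > ENNReal.ofReal t} = {x | t⁻¹ • x ∈ K}ᶜ := by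
  ext x
  simp only [mem_ofPred_eq, mem_compl_iff, gt_iff_lt, ← not_le]
  refine not_congr ⟨fun h => ?_, fun h => ?_⟩
  · have h1 : ENNReal.ofReal t⁻¹ ≤ radial K x := by
      rw [ENNReal.ofReal_inv_of_pos ht]
      exact ENNReal.inv_le_iff_inv_le.1 h
    have hlt {r : ℝ} (hr0 : 0 ≤ r) (hr : r < t⁻¹) : r • x ∈ K := by
      have h2 : ENNReal.ofReal r < radial K x :=
        ((ENNReal.ofReal_lt_ofReal_iff (inv_pos.2 ht)).2 hr).trans_le h1
      simp only [radial, lt_iSup_iff] at h2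
      obtain ⟨q, hq, hrq⟩ := h2
      have hrq' : r < q := by
        rw [← ENNReal.ofReal_coe_nnreal] at hrq
        exact (ENNReal.ofReal_lt_ofReal_iff_of_nonneg hr0).1 hrq
      have hq0 : (0 : ℝ) < q := hr0.trans_lt hrq'
      have h3 := hconv.smul_mem_of_zero_mem h0 hq (t := r / q)
        ⟨div_nonneg hr0 hq0.le, (div_le_one hq0).2 hrq'.le⟩
      rwa [smul_smul, div_mul_cancel₀ _ hq0.ne'] at h3
    have hlim : Tendsto (fun r : ℝ => r • x) (𝓝[<] t⁻¹) (𝓝 (t⁻¹ • x)) :=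
      ((continuous_id.smul continuous_const).tendsto _).mono_left nhdsWithin_le_nhds
    refine hcl.mem_of_tendsto hlim ?_
    filter_upwards [self_mem_nhdsWithin,
      mem_nhdsWithin_of_mem_nhds (Ioi_mem_nhds (inv_pos.2 ht))] with r hr hr0
    exact hlt (le_of_lt hr0) hr
  · rw [ENNReal.inv_le_iff_inv_le, ← ENNReal.ofReal_inv_of_pos ht]
    exact le_iSup₂_of_le (f := fun (r : ℝ≥0) (_ : (r : ℝ) • x ∈ K) => (r : ℝ≥0∞)) t⁻¹.toNNReal
      (by rwa [Real.coe_toNNReal _ (inv_pos.2 ht).le]) le_rfl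

lemma isClosed_cube (n : ℕ) : IsClosed (cube n) := by
  simp only [cube, ofPred_forall]
  exact isClosed_iInter fun i => isClosed_le (by fun_prop) continuous_const

lemma convex_cube (n : ℕ) : Convex ℝ (cube n) := by
  intro x hx y hy a b ha hb hab i
  calc |a * x i + b * y i| ≤ a * |x i| + b * |y i| := by
        refine (abs_add_le _ _).trans ?_
        rw [abs_mul, abs_mul, abs_of_nonneg ha, abs_of_nonneg hb]
    _ ≤ a * 1 + b * 1 := by gcongr <;> [exact hx i; exact hy i]
    _ = 1 := by linarith

lemma setOf_inv_smul_mem_cube {t : ℝ} (ht : 0 < t) :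
    {x : Euc n | t⁻¹ • x ∈ cube n} = {x | ∀ i, |x i| ≤ t} := by
  ext x
  simp only [cube, mem_ofPred_eq, PiLp.smul_apply, smul_eq_mul, abs_mul, abs_inv, abs_of_pos ht,
    inv_mul_le_one₀ ht]

/-- A set cut out by the slabs of an orthonormal basis is a rotation of the cube. -/
lemma isRotationOf_cube_of_orthonormalBasis {K : Set (Euc n)}
    (b : OrthonormalBasis (Fin n) ℝ (Euc n)) (hK : K = {x | ∀ i, |inner ℝ (b i) x| ≤ 1}) :
    IsRotationOf K (cube n) := by
  rcases Nat.eq_zero_or_pos n with rfl | hn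
  · refine ⟨LinearIsometryEquiv.refl ℝ _, by simp, ?_⟩
    rw [hK]
    ext x
    simp [cube]
  have : Nonempty (Fin n) := Fin.pos_iff_nonempty.1 hn
  let e := EuclideanSpace.basisFun (Fin n) ℝ
  -- Changing signs of basis vectors does not affect the slabs and yields determinant one rather
  -- than minus one.
  let b' := b.adjustToOrientation e.toBasis.orientation
  have hb' (i : Fin n) (x : Euc n) : |inner ℝ (b' i) x| = |inner ℝ (b i) x| := by
    rcases b.adjustToOrientation_apply_eq_or_eq_neg e.toBasis.orientation i with h | h
    · rw [show b' i = b i from h]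
    · rw [show b' i = -b i from h, inner_neg_left, abs_neg]
  refine ⟨e.equiv b' (Equiv.refl _), ?_, ?_⟩
  · have h1 : e.toBasis.det b' = 1 := e.det_to_matrix_orthonormalBasis_of_same_orientation b'
      (b.orientation_adjustToOrientation _).symm
    have h2 := e.toBasis.det_comp ((e.equiv b' (Equiv.refl _)).toLinearEquiv : Euc n →ₗ[ℝ] Euc n)
      e.toBasis
    rw [Module.Basis.det_self, mul_one] at h2
    rw [← h2, ← h1]
    congr 1
  · rw [hK]
    ext x
    rw [mem_ofPred_eq, LinearIsometryEquiv.image_eq_preimage_symm]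
    refine forall_congr' fun i => ?_
    rw [← hb']
    have : ((e.equiv b' (Equiv.refl _)).symm x) i = inner ℝ (b' i) x := by
      rw [OrthonormalBasis.equiv_symm, OrthonormalBasis.equiv_apply]
      simp [e, b'.repr_apply_apply, Pi.single_apply]
    change _ ↔ |((e.equiv b' (Equiv.refl _)).symm x) i| ≤ 1
    rw [this]

/-- If the vectors of a unit decomposition are pairwise orthogonal or parallel, then some of them
form an orthonormal basis, and the others are equal to these up to sign. -/
lemma IsUnitDecomposition.exists_orthonormalBasis {ι : Type*} [Fintype ι] {c : ι → ℝ}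
    {u : ι → Euc n} (h : IsUnitDecomposition c u)
    (hu : ∀ i j, inner ℝ (u i) (u j) = 0 ∨ |inner ℝ (u i) (u j)| = 1) :
    ∃ b : OrthonormalBasis (Fin n) ℝ (Euc n),
      (∀ k, ∃ i, b k = u i) ∧ ∀ i, ∃ k, u i = b k ∨ u i = -b k := by
  classical
  let P : Finset ι → Prop := fun J => ∀ i ∈ J, ∀ j ∈ J, i ≠ j → inner ℝ (u i) (u j) = 0
  -- A maximal pairwise orthogonal subfamily: any other vector is non-orthogonal, hence parallel, to
  -- a member, so the subfamily spans.
  obtain ⟨J, hJ⟩ := (Set.toFinite {J : Finset ι | P J}).exists_maximal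
    ⟨∅, fun i hi => absurd hi (Finset.notMem_empty i)⟩
  have hon : Orthonormal ℝ fun j : J => u j :=
    ⟨fun j => h.norm_eq_one j, fun i j hij => hJ.prop i i.2 j j.2 fun h => hij (Subtype.ext h)⟩
  have hrep (i : ι) : ∃ j : J, u i = u j ∨ u i = -u j := by
    by_cases hi : i ∈ J
    · exact ⟨⟨i, hi⟩, Or.inl rfl⟩
    have : ∃ j ∈ J, inner ℝ (u i) (u j) ≠ 0 := by
      by_contra! hcon
      refine hi (hJ.le_of_ge (y := insert i J) ?_ (Finset.subset_insert i J)
        (Finset.mem_insert_self i J))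
      intro k hk l hl hkl
      rcases Finset.mem_insert.1 hk with rfl | hkJ <;> rcases Finset.mem_insert.1 hl with rfl | hlJ
      · exact absurd rfl hkl
      · exact hcon l hlJ
      · rw [real_inner_comm]
        exact hcon k hkJ
      · exact hJ.prop k hkJ l hlJ hkl
    obtain ⟨j, hj, hij⟩ := this
    refine ⟨⟨j, hj⟩, ?_⟩
    rcases eq_or_eq_neg_of_abs_eq ((hu i j).resolve_left hij) with h1 | h1
    · exact Or.inl ((inner_eq_one_iff_of_norm_eq_one (h.norm_eq_one i) (h.norm_eq_one j)).1 h1)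
    · exact Or.inr ((inner_eq_neg_one_iff_of_norm_eq_one (h.norm_eq_one i) (h.norm_eq_one j)).1 h1)
  have hspan : ⊤ ≤ Submodule.span ℝ (range fun j : J => u j) := by
    intro x _
    rw [← h.sum_smul x]
    refine Submodule.sum_mem _ fun i _ => Submodule.smul_mem _ _ ?_
    obtain ⟨j, hj | hj⟩ := hrep i
    · rw [hj]
      exact Submodule.subset_span (mem_range_self j)
    · rw [hj]
      exact Submodule.neg_mem _ (Submodule.subset_span (mem_range_self j))
  let b := OrthonormalBasis.mk hon hspan
  have hcard : Fintype.card J = Fintype.card (Fin n) := by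
    rw [← Module.finrank_eq_card_basis b.toBasis, finrank_euclideanSpace]
  let e := Fintype.equivOfCardEq hcard
  refine ⟨b.reindex e, fun k => ⟨e.symm k, by simp [b]⟩, fun i => ?_⟩
  obtain ⟨j, hj⟩ := hrep i
  exact ⟨e j, by simpa [b] using hj⟩

/-- One can move a little further in the direction `u` inside `A`. The strict bound is needed
because the transport is differentiable only on the open slabs. -/
lemma inner_lt_of_isOpen {A : Set (Euc n)} (hA : IsOpen A) {u : Euc n} (hu : ‖u‖ = 1) {t : ℝ}
    (h : ∀ x ∈ A, inner ℝ u x ≤ t) {x : Euc n} (hx : x ∈ A) : inner ℝ u x < t := by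
  have hc : ContinuousAt (fun s : ℝ => x + s • u) 0 := by fun_prop
  have hn : ∀ᶠ s : ℝ in 𝓝[>] 0, x + s • u ∈ A :=
    mem_nhdsWithin_of_mem_nhds (hc (hA.mem_nhds (by simpa using hx)))
  obtain ⟨s, hs, hs0⟩ := (hn.and self_mem_nhdsWithin).exists
  have h1 := h _ hs
  rw [inner_add_right, real_inner_smul_right, real_inner_self_eq_norm_sq, hu] at h1
  have : 0 < s := hs0
  linarith

lemma isClosed_setOf_inv_smul_mem {K : Set (Euc n)} (hcl : IsClosed K) (t : ℝ) :
    IsClosed {x | t⁻¹ • x ∈ K} :=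
  hcl.preimage (continuous_const_smul t⁻¹)

lemma abs_inner_le_of_symm {ι : Type*} {u : ι → Euc n} {K : Set (Euc n)}
    (hsymm : ∀ x ∈ K, -x ∈ K) (hK : ∀ i, ∀ x ∈ K, inner ℝ (u i) x ≤ 1) {x : Euc n} (hx : x ∈ K) (i : ι) :
    |inner ℝ (u i) x| ≤ 1 := by
  have h1 := hK i _ (hsymm x hx)
  rw [inner_neg_right] at h1
  exact abs_le.2 ⟨by linarith, hK i x hx⟩

/-! ### Comparing a dilate of `K` with the slabs -/

section Comparison

variable {ι : Type*} [Fintype ι] {c : ι → ℝ} {u : ι → Euc n} {K : Set (Euc n)} {t : ℝ}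

lemma interior_setOf_inv_smul_mem_subset_slabs (h : IsUnitDecomposition c u) (ht : 0 < t)
    (hsymm : ∀ x ∈ K, -x ∈ K) (hK : ∀ i, ∀ x ∈ K, inner ℝ (u i) x ≤ 1) :
    interior {x | t⁻¹ • x ∈ K} ⊆ slabs u t := by
  intro x hx i
  have hle (y : Euc n) (hy : y ∈ interior {x | t⁻¹ • x ∈ K}) : |inner ℝ (u i) y| ≤ t := by
    have h1 := abs_inner_le_of_symm hsymm hK (interior_subset hy : y ∈ {x | t⁻¹ • x ∈ K}) i
    rwa [real_inner_smul_right, abs_mul, abs_inv, abs_of_pos ht, inv_mul_le_one₀ ht] at h1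
  refine abs_lt.2 ⟨?_, inner_lt_of_isOpen isOpen_interior (h.norm_eq_one i)
    (fun y hy => (abs_le.1 (hle y hy)).2) hx⟩
  have h1 := inner_lt_of_isOpen isOpen_interior (u := -u i) (by rw [norm_neg, h.norm_eq_one i])
    (fun y hy => by rw [inner_neg_left]; linarith [(abs_le.1 (hle y hy)).1]) hx
  rw [inner_neg_left] at h1
  linarith

/-- The frontier of a convex set is Lebesgue null, hence Gaussian null. -/
lemma stdGaussian_interior_setOf_inv_smul_mem (hconv : Convex ℝ K) (hcl : IsClosed K) :
    stdGaussian (Euc n) (interior {x | t⁻¹ • x ∈ K}) = stdGaussian (Euc n) {x | t⁻¹ • x ∈ K} := by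
  have hc : Convex ℝ {x : Euc n | t⁻¹ • x ∈ K} := hconv.smul_preimage t⁻¹
  have hf := stdGaussian_absolutelyContinuous n (hc.addHaar_frontier volume)
  refine measure_congr ?_
  have := (ae_eq_set (s := interior {x | t⁻¹ • x ∈ K}) (t := {x : Euc n | t⁻¹ • x ∈ K})
    (μ := stdGaussian (Euc n))).2
  refine this ⟨?_, ?_⟩
  · rw [sdiff_eq_empty.2 interior_subset, measure_empty]
  · rwa [(isClosed_setOf_inv_smul_mem hcl t).frontier_eq] at hf

lemma stdGaussian_setOf_inv_smul_mem_le (h : IsUnitDecomposition c u) (ht : 0 < t)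
    (hconv : Convex ℝ K) (hcl : IsClosed K) (hsymm : ∀ x ∈ K, -x ∈ K)
    (hK : ∀ i, ∀ x ∈ K, inner ℝ (u i) x ≤ 1) :
    stdGaussian (Euc n) {x | t⁻¹ • x ∈ K} ≤ ENNReal.ofReal (2 * gaussPrimitive t) ^ n := by
  rw [← stdGaussian_interior_setOf_inv_smul_mem hconv hcl]
  exact (measure_mono (interior_setOf_inv_smul_mem_subset_slabs h ht hsymm hK)).trans
    (stdGaussian_slabs_le h ht)

lemma isRotationOf_cube_of_stdGaussian_eq (h : IsUnitDecomposition c u) (ht : 0 < t)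
    (hconv : Convex ℝ K) (hcl : IsClosed K) (hsymm : ∀ x ∈ K, -x ∈ K)
    (hK : ∀ i, ∀ x ∈ K, inner ℝ (u i) x ≤ 1)
    (heq : stdGaussian (Euc n) {x | t⁻¹ • x ∈ K} = ENNReal.ofReal (2 * gaussPrimitive t) ^ n) :
    IsRotationOf K (cube n) := by
  have hsub := interior_setOf_inv_smul_mem_subset_slabs h ht hsymm hK
  have hint : stdGaussian (Euc n) (interior {x | t⁻¹ • x ∈ K})
      = ENNReal.ofReal (2 * gaussPrimitive t) ^ n :=
    (stdGaussian_interior_setOf_inv_smul_mem hconv hcl).trans heq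
  have hslabs : stdGaussian (Euc n) (slabs u t) = ENNReal.ofReal (2 * gaussPrimitive t) ^ n :=
    (stdGaussian_slabs_le h ht).antisymm (hint ▸ measure_mono hsub)
  -- The part of the slabs outside `tK` is open and Gaussian null, hence empty.
  have hslabsK : slabs u t ⊆ {x | t⁻¹ • x ∈ K} := by
    by_contra hcon
    have hpos := stdGaussian_pos_of_isOpen n
      ((isOpen_slabs u t).sdiff (isClosed_setOf_inv_smul_mem hcl t)) (nonempty_of_not_subset hcon)
    refine hpos.ne' (measure_mono_null (sdiff_subset_sdiff_right interior_subset) ?_)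
    rw [measure_sdiff hsub isOpen_interior.measurableSet.nullMeasurableSet (measure_ne_top _ _),
      hslabs, hint, tsub_self]
  obtain ⟨b, hbu, hub⟩ := h.exists_orthonormalBasis (inner_eq_zero_or_abs_eq_one h ht hslabs)
  refine isRotationOf_cube_of_orthonormalBasis b (Subset.antisymm (fun x hx k => ?_) fun x hx => ?_)
  · obtain ⟨i, hi⟩ := hbu k
    rw [hi]
    exact abs_inner_le_of_symm hsymm hK hx i
  · have hxu (i : ι) : |inner ℝ (u i) x| ≤ 1 := by
      obtain ⟨k, hk | hk⟩ := hub i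
      · rw [hk]
        exact hx k
      · rw [hk, inner_neg_left, abs_neg]
        exact hx k
    -- Only the open slabs are known to lie in `tK`, so a point of the closed polytope is reached as
    -- the limit of `r • x` with `r < 1`.
    have hlim : Tendsto (fun r : ℝ => r • x) (𝓝[<] 1) (𝓝 x) := by
      have := (by fun_prop : Continuous fun r : ℝ => r • x).tendsto 1
      rw [one_smul] at this
      exact this.mono_left nhdsWithin_le_nhds
    refine hcl.mem_of_tendsto hlim ?_
    filter_upwards [self_mem_nhdsWithin,
      mem_nhdsWithin_of_mem_nhds (Ioi_mem_nhds one_pos)] with r hr hr0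
    have hmem : (t * r) • x ∈ slabs u t := fun i => by
      have hr0' : (0 : ℝ) < r := hr0
      have hr' : r < 1 := hr
      rw [real_inner_smul_right, abs_mul, abs_of_pos (mul_pos ht hr0')]
      nlinarith [mul_le_mul_of_nonneg_left (hxu i) (mul_pos ht hr0').le]
    have := hslabsK hmem
    rwa [mem_ofPred_eq, smul_smul, ← mul_assoc, inv_mul_cancel₀ ht.ne', one_mul] at this

end Comparison

lemma stdGaussian_eq_of_isRotationOf {K L : Set (Euc n)} (hL : IsClosed L) (h : IsRotationOf K L)
    (t : ℝ) :
    stdGaussian (Euc n) {x | t⁻¹ • x ∈ K} = stdGaussian (Euc n) {x | t⁻¹ • x ∈ L} := by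
  obtain ⟨R, -, rfl⟩ := h
  have hpre : {x | t⁻¹ • x ∈ R '' L} = R.symm ⁻¹' {x | t⁻¹ • x ∈ L} := by
    ext x
    rw [mem_ofPred_eq, LinearIsometryEquiv.image_eq_preimage_symm]
    simp
  rw [hpre, ← Measure.map_apply R.symm.continuous.measurable
    (isClosed_setOf_inv_smul_mem hL t).measurableSet, stdGaussian_map]

end JohnPosition

open JohnPosition in
theorem mainTheorem3 (n : ℕ) (K : ConvexBody (JohnPosition.Euc n))
    (hint : (interior (K : Set (JohnPosition.Euc n))).Nonempty)
    (hsymm : ∀ x ∈ K, -x ∈ K)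
    (hJohn : JohnPosition.IsMaxVolumeEllipsoid (JohnPosition.unitBall n)
      (K : Set (JohnPosition.Euc n)))
    (t : ℝ) (ht : 0 < t) :
    stdGaussian (JohnPosition.Euc n)
        {x | (JohnPosition.radial (JohnPosition.cube n) x)⁻¹ > ENNReal.ofReal t}
      ≤ stdGaussian (JohnPosition.Euc n)
        {x | (JohnPosition.radial (K : Set (JohnPosition.Euc n)) x)⁻¹ > ENNReal.ofReal t} ∧
    (stdGaussian (JohnPosition.Euc n)
        {x | (JohnPosition.radial (K : Set (JohnPosition.Euc n)) x)⁻¹ > ENNReal.ofReal t}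
      = stdGaussian (JohnPosition.Euc n)
        {x | (JohnPosition.radial (JohnPosition.cube n) x)⁻¹ > ENNReal.ofReal t} ↔
      JohnPosition.IsRotationOf (K : Set (JohnPosition.Euc n)) (JohnPosition.cube n)) := by
  have h0 : (0 : Euc n) ∈ (K : Set (Euc n)) := hJohn.2.1 (by simp [unitBall])
  have hcl : IsClosed (K : Set (Euc n)) := K.isCompact.isClosed
  have key : stdGaussian (Euc n) {x | t⁻¹ • x ∈ (K : Set (Euc n))}
        ≤ stdGaussian (Euc n) {x | t⁻¹ • x ∈ cube n} ∧
      (stdGaussian (Euc n) {x | t⁻¹ • x ∈ (K : Set (Euc n))}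
        = stdGaussian (Euc n) {x | t⁻¹ • x ∈ cube n} ↔
          IsRotationOf (K : Set (Euc n)) (cube n)) := by
    have hrot := fun h => stdGaussian_eq_of_isRotationOf (K := (K : Set (Euc n)))
      (isClosed_cube n) h t
    -- In dimension zero the normalisation by `1 / n` in John's theorem is unavailable, but `K` and
    -- the cube are both the single point.
    rcases eq_or_ne n 0 with rfl | hn
    · have hKc : (K : Set (Euc 0)) = cube 0 :=
        (Set.Nonempty.eq_univ ⟨0, h0⟩).trans
          (Set.Nonempty.eq_univ ⟨0, fun i => i.elim0⟩).symm
      have hR : IsRotationOf (K : Set (Euc 0)) (cube 0) :=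
        ⟨LinearIsometryEquiv.refl ℝ _, by simp, by simp [hKc]⟩
      exact ⟨(hrot hR).le, fun _ => hR, hrot⟩
    · obtain ⟨ι, _, c, u, hcu, hu⟩ := exists_isUnitDecomposition hn K.convex hcl hJohn
      have hcube : stdGaussian (Euc n) {x | t⁻¹ • x ∈ cube n}
          = ENNReal.ofReal (2 * gaussPrimitive t) ^ n := by
        rw [setOf_inv_smul_mem_cube ht, stdGaussian_setOf_abs_le n ht.le]
      refine ⟨?_, fun heq => ?_, hrot⟩
      · rw [hcube]
        exact stdGaussian_setOf_inv_smul_mem_le hcu ht K.convex hcl hsymm hu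
      · exact isRotationOf_cube_of_stdGaussian_eq hcu ht K.convex hcl hsymm hu (heq.trans hcube)
  -- Complements in a probability space reverse the inequality and preserve equality.
  rw [setOf_lt_inv_radial K.convex hcl h0 ht,
    setOf_lt_inv_radial (convex_cube n) (isClosed_cube n) (fun i => by simp) ht,
    prob_compl_eq_one_sub (isClosed_setOf_inv_smul_mem hcl t).measurableSet,
    prob_compl_eq_one_sub (isClosed_setOf_inv_smul_mem (isClosed_cube n) t).measurableSet]
  refine ⟨tsub_le_tsub_left key.1 1, ?_⟩
  rw [ENNReal.sub_right_inj ENNReal.one_ne_top prob_le_one prob_le_one]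
  exact key.2
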